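/- Let $G=(V,E)$ be a finite graph, possibly with loops or multiple edges, with complex edge weights $\lambda=(\lambda_e)_{e\in E}$. For $H\subseteq E$ and $v\in V$ let $\deg(H,v)$ be the degree of $v$ in the spanning subgraph $(V,H)$ (a loop at $v$ counts twice), and write $\deg(G,v)=\deg(E,v)$. For each $v\in V$ let $u^{(v)}_0,\dots,u^{(v)}_{d}$ with $d=\deg(G,v)$ be complex numbers (the activities at $v$). Put $$Z(G,\lambda,u;x)=\sum_{H\subseteq E}\Big(\prod_{e\in H}\lambda_e\Big)\Big(\prod_{v\in V}u^{(v)}_{\deg(H,v)}\,x_v^{\deg(H,v)}\Big),\qquad K_v(z)=\sum_{j=0}^{d}\binom{d}{j}u^{(v)}_j z^j\quad(d=\deg(G,v)).$$ For $A\subseteq\mathbb{C}$, a polynomial $F$ in complex variables is called $A$-nonvanishing if either $F$ is identically zero, or $F\neq 0$ whenever all of its variables take values in $A$. For $0<\theta\le\pi$ let $S[\theta]=\{z\in\mathbb{C}: z\ne 0,\ |\arg z|<\theta\}$, where $-\pi<\arg z\le\pi$; for $\kappa>0$ let $\kappa D=\{z\in\mathbb{C}:|z|<\kappa\}$ and $\kappa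 E=\{z\in\mathbb{C}:|z|>\kappa\}$. **Theorem.** (a) Let $0\le\alpha<\pi/2$. If $\lambda_e$ is real and $\lambda_e\ge 0$ for every $e\in E$, and $K_v$ is $S[\pi-\alpha]$-nonvanishing for every $v\in V$, then $Z(G,\lambda,u;x)$ is $S[\pi/2-\alpha]$-nonvanishing. (b) Let $\kappa>0$ and $\lambda_{\max}>0$. If $|\lambda_e|\le\lambda_{\max}$ for every $e\in E$, and $K_v$ is $\kappa D$-nonvanishing for every $v\in V$, then $Z(G,\lambda,u;x)$ is $(\kappa/\lambda_{\max}^{1/2})D$-nonvanishing. (c) Let $\kappa>0$ and $\lambda_{\min}>0$. If $|\lambda_e|\ge\lambda_{\min}$ for every $e\in E$, and $K_v$ is $\kappa E$-nonvanishing with $\deg K_v=\deg(G,v)$ for every $v\in V$, then $Z(G,\lambda,u;x)$ is $(\kappa/\lambda_{\min}^{1/2})E$-nonvanishing. -/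

import Mathlib

open scoped Graph ComplexOrder

noncomputable section

open Classical in
/-- The degree `deg(H, v)` of the vertex `v` in the spanning subgraph of the multigraph `G` with
edge set `H ⊆ E(G)`: the number of edges of `H` incident with `v`, every loop at `v` being
counted twice. -/
def Graph.degreeIn {α β : Type*} (G : Graph α β) (H : Finset E(G)) (v : V(G)) : ℕ :=
  (H.filter fun e : E(G) => G.Inc e v).card + (H.filter fun e : E(G) => G.IsLoopAt e v).card

/-- The degree `deg(G, v)` of a vertex in a multigraph with finitely many edges. -/
def Graph.degree {α β : Type*} (G : Graph α β) [Fintype E(G)] (v : V(G)) : ℕ :=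
  G.degreeIn Finset.univ v

/-- The polynomial `Z(G, lam, u; x) = ∑_{H ⊆ E} lam^H u_{deg H} x^{deg H}` in the variables
`x_v`, `v ∈ V(G)`.  Only the activities `u v j` with `j ≤ deg(G, v)` occur in it. -/
def Graph.subgraphPoly {α β : Type*} (G : Graph α β) [Fintype V(G)] [Fintype E(G)]
    (lam : E(G) → ℂ) (u : V(G) → ℕ → ℂ) : MvPolynomial V(G) ℂ :=
  ∑ H : Finset E(G),
    MvPolynomial.C ((∏ e ∈ H, lam e) * ∏ v : V(G), u v (G.degreeIn H v)) *
      ∏ v : V(G), MvPolynomial.X v ^ G.degreeIn H v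

/-- The key polynomial `K_v(z) = ∑_{j=0}^{d} (d choose j) u_j^{(v)} z^j` with `d = deg(G, v)`. -/
def Graph.keyPoly {α β : Type*} (G : Graph α β) [Fintype E(G)]
    (u : V(G) → ℕ → ℂ) (v : V(G)) : Polynomial ℂ :=
  ∑ j ∈ Finset.range (G.degree v + 1),
    Polynomial.C (((G.degree v).choose j : ℂ) * u v j) * Polynomial.X ^ j

/-- A polynomial in several complex variables is `A`-nonvanishing if it is identically zero or
it does not vanish when all its variables lie in `A`. -/
def MvPolynomial.IsNonvanishing {σ : Type*} (A : Set ℂ) (F : MvPolynomial σ ℂ) : Prop :=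
  F = 0 ∨ ∀ z : σ → ℂ, (∀ v, z v ∈ A) → MvPolynomial.eval z F ≠ 0

/-- A polynomial in one complex variable is `A`-nonvanishing if it is identically zero or
it does not vanish at any point of `A`. -/
def Polynomial.IsNonvanishing (A : Set ℂ) (K : Polynomial ℂ) : Prop :=
  K = 0 ∨ ∀ z ∈ A, K.eval z ≠ 0

/-- The open sector `S[θ]`. -/
def openSector (θ : ℝ) : Set ℂ := {z | z ≠ 0 ∧ |z.arg| < θ}

/-- The open disk `κD`, of radius `κ` about the origin. -/
def openDisk (κ : ℝ) : Set ℂ := {z | ‖z‖ < κ}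

/-- The open exterior `κE` of the disk of radius `κ` about the origin. -/
def openExterior (κ : ℝ) : Set ℂ := {z | κ < ‖z‖}

end

/- Let `s e` and `t e` be the ends of the edge `e`. The polynomial `Z` is the image of
`∏ e, (1 + λ e • X (s e) * X (t e))` under the linear operator which multiplies every monomial by
the corresponding activities. If the product is replaced by
`∏ e, (1 + z e • X (s e)) * (1 + z' e • X (t e))`, with independent numbers at the half-edges, then
the resulting polynomial is a product over the vertices of the polarizations of `z ↦ K_v (x_v z)`.
By the theorem of Grace, Walsh and Szegő it does not vanish as long as all `z e` and `z' e` lie in a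
disk or half-plane `S` on which no `z ↦ K_v (x_v z)` has a zero. Asano contraction then recovers the
edge factors one by one, provided that `-λ e` is not a product of two points outside `S`.

For (b), `S` is a disk about `0`. For (a), `S` is the right half-plane, which has `0` only as a
boundary point: the contraction is based at `δ ∈ S` instead of `0`, and Hurwitz's theorem allows
`δ → 0`. Finally, (c) follows from (b) by complementation of edge sets. -/

section

open Multiset (replicate)
open scoped Polynomial Topology

section Laguerre

/-- An open disk or an open half-plane (or, in the degenerate cases, `∅` or `ℂ`), given as the set
where a real quadratic `(b z).re + c - a |z|²` with `0 ≤ a` is positive: the sets to which the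
theorems of Laguerre and of Grace, Walsh and Szegő apply without a condition on degrees. -/
def IsConvexCircularRegion (S : Set ℂ) : Prop :=
  ∃ (a : ℝ) (b : ℂ) (c : ℝ), 0 ≤ a ∧ S = {z | 0 < (b * z).re + c - a * Complex.normSq z}

theorem isConvexCircularRegion_openDisk {κ : ℝ} (hκ : 0 ≤ κ) :
    IsConvexCircularRegion (openDisk κ) := by
  refine ⟨1, 0, κ ^ 2, zero_le_one, Set.ext fun z => ?_⟩
  simp [openDisk, Complex.normSq_eq_norm_sq, sq_lt_sq₀ (norm_nonneg z) hκ]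

theorem isConvexCircularRegion_re_pos : IsConvexCircularRegion {z | 0 < z.re} :=
  ⟨0, 1, 0, le_rfl, by simp⟩

namespace IsConvexCircularRegion

/-- The half-plane in question is bounded by the line `Re (w ζ) = 0`. As `r = ∞` is mapped to `1`,
the inequality `0 < w.re` is the case of the point at infinity. -/
theorem exists_halfPlane {S : Set ℂ} (hS : IsConvexCircularRegion S) {y z : ℂ} (hy : y ∈ S)
    (hz : z ∈ S) : ∃ w : ℂ, 0 < w.re ∧ ∀ r ∉ S, 0 < (w * ((y - r) / (z - r))).re := by
  obtain ⟨a, b, c, ha, rfl⟩ := hS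
  set q : ℂ → ℝ := fun z => (b * z).re + c - a * Complex.normSq z with hq
  replace hy : 0 < q y := hy
  replace hz : 0 < q z := hz
  -- Twice the polar form, at `(y, z)`, of the Hermitian form whose diagonal is `q`.
  let w : ℂ := star (b * y) + b * z + 2 * c - 2 * a * (star y * z)
  refine ⟨w, ?_, fun r hr => ?_⟩
  · have polarization : w.re = q y + q z + a * Complex.normSq (y - z) := by
      simp [w, hq, Complex.normSq_apply]
      ring
    have := mul_nonneg ha (Complex.normSq_nonneg (y - z))
    linarith
  · replace hr : q r ≤ 0 := not_lt.mp hr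
    have hzr : 0 < Complex.normSq (z - r) := by
      rw [Complex.normSq_pos, sub_ne_zero]
      rintro rfl
      exact hz.not_ge hr
    have key : (w * ((y - r) / (z - r))).re = (q y * Complex.normSq (z - r) +
        q z * Complex.normSq (y - r) - q r * Complex.normSq (y - z)) / Complex.normSq (z - r) := by
      rw [div_eq_mul_inv, Complex.inv_def, ← mul_assoc, ← mul_assoc, Complex.re_mul_ofReal,
        ← div_eq_mul_inv]
      congr 1
      simp [w, hq, Complex.normSq_apply]
      ring
    rw [key]
    have h1 := mul_pos hy hzr
    have h2 := mul_nonneg hz.le (Complex.normSq_nonneg (y - r))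
    have h3 := mul_nonneg (neg_nonneg.mpr hr) (Complex.normSq_nonneg (y - z))
    exact div_pos (by linarith) hzr

end IsConvexCircularRegion

theorem polarDerivative_div_eval {K : Type*} [Field K] {p : K[X]} (hp : p.Splits) {n : ℕ}
    (hn : p.natDegree ≤ n) (y : K) {z : K} (hz : p.eval z ≠ 0) :
    n + (y - z) * (p.derivative.eval z / p.eval z) =
      (replicate (n - p.natDegree) 1 + p.roots.map fun r => (y - r) / (z - r)).sum := by
  have hterm : ∀ r ∈ p.roots, (y - r) / (z - r) = 1 + (y - z) * (1 / (z - r)) := by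
    intro r hr
    have : z - r ≠ 0 := by
      rw [sub_ne_zero]
      rintro rfl
      exact hz (Polynomial.isRoot_of_mem_roots hr)
    field_simp
    ring
  rw [hp.eval_derivative_div_eval_of_ne_zero hz, Multiset.sum_add, Multiset.map_congr rfl hterm,
    Multiset.sum_map_add, Multiset.sum_map_mul_left, Multiset.map_const', Multiset.sum_replicate,
    Multiset.sum_replicate, ← hp.natDegree_eq_card_roots, ← add_assoc, ← add_smul,
    Nat.sub_add_cancel hn, nsmul_one]

/-- Laguerre's theorem: the points `(y - r) / (z - r)`, for `r` a root of `p` or `r = ∞`, lie in a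
common open half-plane. -/
theorem IsConvexCircularRegion.polarDerivative_ne_zero {S : Set ℂ} (hS : IsConvexCircularRegion S)
    {p : ℂ[X]} {n : ℕ} (hn : n ≠ 0) (hp : p.natDegree ≤ n) (h : ∀ z ∈ S, p.eval z ≠ 0) {y z : ℂ}
    (hy : y ∈ S) (hz : z ∈ S) : n * p.eval z + (y - z) * p.derivative.eval z ≠ 0 := by
  obtain ⟨w, hw, hwr⟩ := hS.exists_halfPlane hy hz
  have hsplit := IsAlgClosed.splits p
  suffices 0 < (w * (n + (y - z) * (p.derivative.eval z / p.eval z))).re by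
    have hpz := h z hz
    contrapose! this
    rw [← mul_div_assoc, add_div' _ _ _ hpz, this, zero_div, mul_zero, Complex.zero_re]
  rw [polarDerivative_div_eval hsplit hp y (h z hz)]
  refine Multiset.sum_induction_nonempty (fun ζ => 0 < (w * ζ).re) (fun ζ ξ hζ hξ => ?_) ?_ ?_
  · rw [mul_add, Complex.add_re]
    exact add_pos hζ hξ
  · rw [Multiset.empty_eq_zero, ← Multiset.card_pos, Multiset.card_add, Multiset.card_replicate,
      Multiset.card_map, ← hsplit.natDegree_eq_card_roots, Nat.sub_add_cancel hp]
    exact Nat.pos_of_ne_zero hn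
  · intro ζ hζ
    rcases Multiset.mem_add.mp hζ with hζ | hζ
    · simpa [Multiset.eq_of_mem_replicate hζ] using hw
    · obtain ⟨r, hr, rfl⟩ := Multiset.mem_map.mp hζ
      exact hwr r fun hrS => h r hrS (Polynomial.isRoot_of_mem_roots hr)

end Laguerre

theorem exists_polynomial_eval_eq_map_eval {R A : Type*} [CommRing R] [CommRing A] [Algebra R A]
    (L : A →ₗ[R] R) (q : A[X]) : ∃ p : R[X], p.natDegree ≤ q.natDegree ∧
      ∀ z, p.eval z = L (q.eval (algebraMap R A z)) ∧
        p.derivative.eval z = L (q.derivative.eval (algebraMap R A z)) := by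
  have map_mul (c : A) (r : R) : L (c * algebraMap R A r) = L c * r := by
    rw [mul_comm, ← Algebra.smul_def, map_smul, smul_eq_mul, mul_comm]
  refine ⟨∑ j ∈ q.support, Polynomial.monomial j (L (q.coeff j)),
    Polynomial.natDegree_sum_le_of_forall_le _ _ fun j hj =>
      (Polynomial.natDegree_monomial_le _).trans (Polynomial.le_natDegree_of_mem_supp j hj),
    fun z => ⟨?_, ?_⟩⟩
  · simp only [Polynomial.eval_finsetSum, Polynomial.eval_monomial, Polynomial.eval_eq_sum (p := q),
      Polynomial.sum, map_sum, ← map_pow, map_mul]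
  · simp only [Polynomial.derivative_monomial, Polynomial.eval_finsetSum,
      Polynomial.eval_monomial, Polynomial.derivative_eval q, Polynomial.sum, map_sum, mul_assoc,
      ← map_natCast (algebraMap R A), ← map_pow, ← _root_.map_mul, map_mul]

section GraceWalshSzego

variable {A : Type*} [CommRing A] [Algebra ℂ A] {S : Set ℂ}

namespace IsConvexCircularRegion

theorem map_mul_pow_ne_zero (hS : IsConvexCircularRegion S) (L : A →ₗ[ℂ] ℂ) {a : A} {n : ℕ}
    (h : ∀ z ∈ S, L ((1 + z • a) ^ (n + 1)) ≠ 0) {y z : ℂ} (hy : y ∈ S) (hz : z ∈ S) :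
    L ((1 + y • a) * (1 + z • a) ^ n) ≠ 0 := by
  obtain ⟨p, hdeg, hp⟩ := exists_polynomial_eval_eq_map_eval L
    ((1 + Polynomial.C a * Polynomial.X) ^ (n + 1))
  have heval (z : ℂ) : p.eval z = L ((1 + z • a) ^ (n + 1)) := by
    rw [(hp z).1]
    simp only [Polynomial.eval_pow, Polynomial.eval_add, Polynomial.eval_one, Polynomial.eval_mul,
      Polynomial.eval_C, Polynomial.eval_X, Algebra.smul_def, mul_comm a]
  have hderiv (z : ℂ) : p.derivative.eval z = (n + 1) * L (a * (1 + z • a) ^ n) := by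
    have : ((n + 1 : ℂ) • (a * (1 + z • a) ^ n) : A) =
        ((1 + Polynomial.C a * Polynomial.X) ^ (n + 1)).derivative.eval (algebraMap ℂ A z) := by
      simp only [Polynomial.derivative_pow_succ, Polynomial.derivative_add,
        Polynomial.derivative_one, Polynomial.derivative_C_mul, Polynomial.derivative_X, zero_add,
        Polynomial.eval_mul, Polynomial.eval_pow, Polynomial.eval_add, Polynomial.eval_one,
        Polynomial.eval_C, Polynomial.eval_X, Algebra.smul_def]
      push_cast
      ring
    rw [(hp z).2, ← this, map_smul, smul_eq_mul]
  have hlaguerre := hS.polarDerivative_ne_zero n.succ_ne_zero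
    (hdeg.trans <| Polynomial.natDegree_pow_le_of_le (m := 1) (n + 1) (by compute_degree) |>.trans
      (by simp)) (fun w hw => (heval w).trans_ne (h w hw)) hy hz
  have hsplit : (1 + y • a) * (1 + z • a) ^ n =
      (1 + z • a) ^ (n + 1) + (y - z) • (a * (1 + z • a) ^ n) := by
    simp only [Algebra.smul_def, map_sub]
    ring
  contrapose! hlaguerre
  rw [hsplit, map_add, map_smul, smul_eq_mul] at hlaguerre
  rw [heval, hderiv]
  push_cast
  linear_combination (n + 1 : ℂ) * hlaguerre

/-- The Grace–Walsh–Szegő theorem: every symmetric multiaffine polynomial in the `y i` is of the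
form `L (∏ i, (1 + y i • X))` with `L` linear on `ℂ[X]`. -/
theorem map_prod_ne_zero (hS : IsConvexCircularRegion S) (hne : S.Nonempty) {ι : Type*}
    {T : Finset ι} (L : A →ₗ[ℂ] ℂ) {a : A} (h : ∀ z ∈ S, L ((1 + z • a) ^ T.card) ≠ 0) {y : ι → ℂ}
    (hy : ∀ i ∈ T, y i ∈ S) : L (∏ i ∈ T, (1 + y i • a)) ≠ 0 := by
  classical
  induction T using Finset.induction_on generalizing L with
  | empty =>
    obtain ⟨z, hz⟩ := hne
    simpa using h z hz
  | insert i T hi ih =>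
    obtain ⟨hyi, hyT⟩ := Finset.forall_mem_insert .. |>.mp hy
    rw [Finset.prod_insert hi]
    rw [Finset.card_insert_of_notMem hi] at h
    exact ih (L ∘ₗ LinearMap.mulLeft ℂ (1 + y i • a))
      (fun z hz => hS.map_mul_pow_ne_zero L h hyi hz) hyT

theorem map_prod_ne_zero_of_fiberwise (hS : IsConvexCircularRegion S) (hne : S.Nonempty)
    {ι V : Type*} [Fintype ι] [Finite V] (f : ι → V) (L : A →ₗ[ℂ] ℂ) {a : V → A}
    (h : ∀ w : V → ℂ, (∀ v, w v ∈ S) → L (∏ i, (1 + w (f i) • a (f i))) ≠ 0) {y : ι → ℂ}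
    (hy : ∀ i, y i ∈ S) : L (∏ i, (1 + y i • a (f i))) ≠ 0 := by
  classical
  cases nonempty_fintype V
  -- Release the variables of one fibre at a time: `W` is the set of vertices already treated.
  suffices ∀ (W : Finset V) (w : V → ℂ), (∀ v, w v ∈ S) →
      L (∏ i, (1 + (if f i ∈ W then y i else w (f i)) • a (f i))) ≠ 0 by
    obtain ⟨z, hz⟩ := hne
    simpa using this Finset.univ (fun _ => z) fun _ => hz
  intro W
  induction W using Finset.induction_on with
  | empty => simpa using h
  | insert v W hv ih =>
    intro w hw
    set Q : A := ∏ i with f i ≠ v, (1 + (if f i ∈ W then y i else w (f i)) • a (f i)) with hQ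
    have hfiber : L ((∏ i with f i = v, (1 + y i • a v)) * Q) ≠ 0 := by
      refine hS.map_prod_ne_zero hne (L ∘ₗ LinearMap.mulRight ℂ Q) (fun z hz => ?_) fun i _ => hy i
      have := ih (Function.update w v z) fun v' => by
        rcases eq_or_ne v' v with rfl | hv' <;> simp [*]
      rw [← Finset.prod_filter_mul_prod_filter_not _ (f · = v)] at this
      rw [LinearMap.comp_apply, LinearMap.mulRight_apply]
      convert this using 3
      · exact (Finset.prod_eq_pow_card fun i hi => by simp [(Finset.mem_filter.mp hi).2, hv]).symm
      · exact Finset.prod_congr rfl fun i hi => by simp [(Finset.mem_filter.mp hi).2]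
    rw [← Finset.prod_filter_mul_prod_filter_not _ (f · = v)]
    convert hfiber using 3
    · exact Finset.prod_congr rfl fun i hi => by simp [(Finset.mem_filter.mp hi).2]
    · exact Finset.prod_congr rfl fun i hi => by simp [(Finset.mem_filter.mp hi).2]

end IsConvexCircularRegion

end GraceWalshSzego

section AsanoContraction

/-- The factor contributed by an edge with weight `l`, `a` and `b` being the variables at its two
ends. At `δ = 0` this is `1 + l a b`; a nonzero `δ` serves for regions `S` which do not contain `0`,
such as an open half-plane. -/
def edgeFactor {R A : Type*} [CommRing R] [CommRing A] [Algebra R A] (δ l : R) (a b : A) : A :=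
  (1 + δ • a) * (1 + δ • b) + l • (a * b)

variable {K : Type*} [Field K] [IsAlgClosed K] {S : Set K} {δ : K}

theorem asano_contraction_ne_zero {l a b d : K} (hδ : δ ∈ S)
    (hl : ∀ r ∉ S, ∀ r' ∉ S, (r - δ) * (r' - δ) + l ≠ 0)
    (h : ∀ z ∈ S, a + (z - δ) * b + (z - δ) ^ 2 * d ≠ 0) : a + l * d ≠ 0 := by
  rcases eq_or_ne d 0 with rfl | hd
  · simpa using h δ hδ
  obtain ⟨r, hr⟩ := IsAlgClosed.exists_root
    (Polynomial.C d * Polynomial.X ^ 2 + Polynomial.C b * Polynomial.X + Polynomial.C a)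
    (by rw [Polynomial.degree_quadratic hd]; decide)
  replace hr : d * r ^ 2 + b * r + a = 0 := by simpa using hr
  -- By Vieta the two roots `r` and `r'` have product `a / d`.
  obtain ⟨r', hr'⟩ : ∃ r', d * (r + r') = -b := ⟨-b / d - r, by field_simp; ring⟩
  have not_mem {w : K} (hw : d * w ^ 2 + b * w + a = 0) : δ + w ∉ S := fun hwS => by
    apply h _ hwS
    linear_combination hw
  intro h0
  refine hl _ (not_mem hr) _ (not_mem (w := r') ?_) (mul_left_cancel₀ hd ?_)
  · linear_combination hr + (r' - r) * hr'
  · linear_combination h0 - hr + r * hr'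

variable {A : Type*} [CommRing A] [Algebra K A]

theorem map_edgeFactor_ne_zero (L : A →ₗ[K] K) {a b : A} {l : K} (hδ : δ ∈ S)
    (hl : ∀ r ∉ S, ∀ r' ∉ S, (r - δ) * (r' - δ) + l ≠ 0)
    (h : ∀ z ∈ S, L ((1 + z • a) * (1 + z • b)) ≠ 0) : L (edgeFactor δ l a b) ≠ 0 := by
  rw [edgeFactor, map_add, map_smul, smul_eq_mul]
  refine asano_contraction_ne_zero (b := L (a * (1 + δ • b) + b * (1 + δ • a))) hδ hl
    fun z hz => ?_
  have taylor : (1 + z • a) * (1 + z • b) = (1 + δ • a) * (1 + δ • b) +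
      (z - δ) • (a * (1 + δ • b) + b * (1 + δ • a)) + (z - δ) ^ 2 • (a * b) := by
    simp only [Algebra.smul_def, map_sub, map_pow]
    ring
  simpa only [taylor, map_add, map_smul, smul_eq_mul] using h z hz

theorem map_prod_edgeFactor_ne_zero {ι : Type*} {T : Finset ι} {a b : ι → A} {l : ι → K}
    (hδ : δ ∈ S) (hl : ∀ e ∈ T, ∀ r ∉ S, ∀ r' ∉ S, (r - δ) * (r' - δ) + l e ≠ 0) (L : A →ₗ[K] K)
    (h : ∀ z : ι → K, (∀ e, z e ∈ S) → L (∏ e ∈ T, (1 + z e • a e) * (1 + z e • b e)) ≠ 0) :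
    L (∏ e ∈ T, edgeFactor δ (l e) (a e) (b e)) ≠ 0 := by
  classical
  induction T using Finset.induction_on generalizing L with
  | empty => simpa using h (fun _ => δ) fun _ => hδ
  | insert e T he ih =>
    rw [Finset.prod_insert he]
    refine ih (fun f hf => hl f (Finset.mem_insert_of_mem hf))
      (L ∘ₗ LinearMap.mulLeft K (edgeFactor δ (l e) (a e) (b e))) fun z hz => ?_
    refine map_edgeFactor_ne_zero
      (L ∘ₗ LinearMap.mulRight K (∏ f ∈ T, (1 + z f • a f) * (1 + z f • b f))) hδ
      (hl e (Finset.mem_insert_self e T)) fun w hw => ?_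
    have hupdate : ∀ f, Function.update z e w f ∈ S := fun f => by
      rcases eq_or_ne f e with rfl | hf <;> simp [*]
    have := h _ hupdate
    rwa [Finset.prod_insert he, Function.update_self, Finset.prod_congr rfl fun f hf => by
      rw [Function.update_of_ne (ne_of_mem_of_not_mem hf he)]] at this

end AsanoContraction

theorem totalDegree_edgeFactor_le {σ R : Type*} [CommRing R] (δ l : R) {p q : MvPolynomial σ R}
    (hp : p.totalDegree ≤ 1) (hq : q.totalDegree ≤ 1) : (edgeFactor δ l p q).totalDegree ≤ 2 := by
  have hlin {r : MvPolynomial σ R} (hr : r.totalDegree ≤ 1) : (1 + δ • r).totalDegree ≤ 1 :=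
    (MvPolynomial.totalDegree_add _ _).trans
      (max_le (by simp) ((MvPolynomial.totalDegree_smul_le _ _).trans hr))
  refine (MvPolynomial.totalDegree_add _ _).trans (max_le ?_ ?_)
  · exact (MvPolynomial.totalDegree_mul _ _).trans (add_le_add (hlin hp) (hlin hq))
  · exact (MvPolynomial.totalDegree_smul_le _ _).trans
      ((MvPolynomial.totalDegree_mul _ _).trans (add_le_add hp hq))

theorem continuous_map_prod_edgeFactor {R A ι : Type*} [CommRing R] [TopologicalSpace R]
    [IsTopologicalSemiring R] [CommRing A] [Algebra R A] (L : A →ₗ[R] R) (T : Finset ι) (l : ι → R)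
    (a b : ι → A) : Continuous fun δ : R => L (∏ e ∈ T, edgeFactor δ (l e) (a e) (b e)) := by
  obtain ⟨p, -, hp⟩ := exists_polynomial_eval_eq_map_eval L
    (∏ e ∈ T, edgeFactor Polynomial.X (Polynomial.C (algebraMap R A (l e))) (Polynomial.C (a e))
      (Polynomial.C (b e)))
  convert p.continuous using 2 with δ
  rw [(hp δ).1, Polynomial.eval_prod]
  simp only [edgeFactor, Algebra.smul_def, Algebra.algebraMap_self_apply, Polynomial.eval_add,
    Polynomial.eval_mul, Polynomial.eval_one, Polynomial.eval_X, Polynomial.eval_C]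

section ApplyActivities

variable {σ R : Type*} [Fintype σ] [CommRing R] (u : σ → ℕ → R)

/-- The linear operator multiplying the coefficient of the monomial `∏ v, X v ^ m v` by
`∏ v, u v (m v)`. -/
noncomputable def applyActivities : MvPolynomial σ R →ₗ[R] MvPolynomial σ R :=
  (MvPolynomial.basisMonomials σ R).constr R fun m => MvPolynomial.monomial m (∏ v, u v (m v))

theorem applyActivities_monomial (m : σ →₀ ℕ) (c : R) :
    applyActivities u (MvPolynomial.monomial m c) =
      MvPolynomial.monomial m (c * ∏ v, u v (m v)) := by
  have hone : applyActivities u (MvPolynomial.monomial m 1) =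
      MvPolynomial.monomial m (∏ v, u v (m v)) :=
    (MvPolynomial.basisMonomials σ R).constr_basis R _ m
  rw [← mul_one c, ← smul_eq_mul, ← MvPolynomial.smul_monomial, map_smul, hone,
    MvPolynomial.smul_monomial, smul_eq_mul, smul_eq_mul, mul_one]

theorem applyActivities_C_mul_prod_X_pow (c : R) (m : σ → ℕ) :
    applyActivities u (MvPolynomial.C c * ∏ v, MvPolynomial.X v ^ m v) =
      MvPolynomial.C (c * ∏ v, u v (m v)) * ∏ v, MvPolynomial.X v ^ m v := by
  have hmonomial (c : R) : MvPolynomial.C c * ∏ v, MvPolynomial.X v ^ m v =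
      MvPolynomial.monomial (Finsupp.equivFunOnFinite.symm m) c := by
    rw [MvPolynomial.monomial_eq, Finsupp.prod_fintype _ _ fun _ => pow_zero _]
    rfl
  rw [hmonomial, hmonomial, applyActivities_monomial]
  rfl

theorem totalDegree_applyActivities_le (p : MvPolynomial σ R) :
    (applyActivities u p).totalDegree ≤ p.totalDegree := by
  rw [p.as_sum, map_sum, ← p.as_sum]
  refine MvPolynomial.totalDegree_finsetSum_le fun m hm => ?_
  rw [applyActivities_monomial]
  exact (MvPolynomial.totalDegree_monomial_le _ _).trans (MvPolynomial.le_totalDegree hm)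

theorem eval_applyActivities_prod (d : σ → ℕ) (x w : σ → R) :
    MvPolynomial.eval x (applyActivities u (∏ v, (1 + w v • MvPolynomial.X v) ^ d v)) =
      ∏ v, ∑ j ∈ Finset.range (d v + 1), (d v).choose j * u v j * (x v * w v) ^ j := by
  classical
  have hbinomial (v : σ) : (1 + w v • MvPolynomial.X v : MvPolynomial σ R) ^ d v =
      ∑ j ∈ Finset.range (d v + 1),
        MvPolynomial.C ((d v).choose j * w v ^ j) * MvPolynomial.X v ^ j := by
    rw [add_comm, add_pow]
    refine Finset.sum_congr rfl fun j _ => ?_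
    rw [MvPolynomial.smul_eq_C_mul, one_pow, map_mul, map_natCast, map_pow]
    ring
  simp only [hbinomial]
  rw [Finset.prod_univ_sum, Finset.prod_univ_sum, map_sum, map_sum]
  refine Finset.sum_congr rfl fun m _ => ?_
  rw [Finset.prod_mul_distrib, ← map_prod, applyActivities_C_mul_prod_X_pow, map_mul,
    MvPolynomial.eval_C, map_prod, ← Finset.prod_mul_distrib, ← Finset.prod_mul_distrib]
  refine Finset.prod_congr rfl fun v _ => ?_
  rw [map_pow, MvPolynomial.eval_X]
  ring

end ApplyActivities

section Hurwitz

open Filter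

theorem norm_eval_le_of_forall_eval_ne_zero {p : ℂ[X]} {r : ℝ} (hr : 0 < r) {n : ℕ}
    (hn : p.natDegree ≤ n) (h : ∀ t : ℂ, ‖t‖ < r → p.eval t ≠ 0) (t : ℂ) :
    ‖p.eval t‖ ≤ ‖p.eval 0‖ * (1 + ‖t‖ / r) ^ n := by
  have hbase : 0 ≤ ‖t‖ / r := by positivity
  have heval (w : ℂ) : ‖p.eval w‖ = ‖p.leadingCoeff‖ * (p.roots.map fun s => ‖w - s‖).prod := by
    rw [(IsAlgClosed.splits p).eval_eq_prod_roots, norm_mul]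
    exact congrArg _ ((map_multiset_prod (normHom : ℂ →*₀ ℝ) _).trans <| by
      rw [Multiset.map_map]; rfl)
  have hroot : ∀ s ∈ p.roots, ‖t - s‖ ≤ ‖0 - s‖ * (1 + ‖t‖ / r) := by
    intro s hs
    have hrs : r ≤ ‖s‖ := not_lt.mp fun hlt => h s hlt (Polynomial.isRoot_of_mem_roots hs)
    calc ‖t - s‖ ≤ ‖s‖ + r * (‖t‖ / r) := by
          rw [mul_div_cancel₀ _ hr.ne', add_comm]
          exact norm_sub_le t s
      _ ≤ ‖s‖ + ‖s‖ * (‖t‖ / r) := by gcongr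
      _ = ‖0 - s‖ * (1 + ‖t‖ / r) := by rw [zero_sub, norm_neg]; ring
  have hprod := Multiset.prod_map_le_prod_map₀ _ _ (fun s _ => norm_nonneg _) hroot
  rw [Multiset.prod_map_mul, Multiset.map_const', Multiset.prod_replicate,
    IsAlgClosed.card_roots_eq_natDegree] at hprod
  calc ‖p.eval t‖ ≤ ‖p.eval 0‖ * (1 + ‖t‖ / r) ^ p.natDegree := by
        rw [heval, heval, mul_assoc]
        gcongr
    _ ≤ ‖p.eval 0‖ * (1 + ‖t‖ / r) ^ n := by
        gcongr
        linarith

/-- Hurwitz's theorem for polynomials of bounded degree in several variables: the norm bound passes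
to the limit along every complex line. -/
theorem isNonvanishing_of_tendsto {σ κ : Type*} [Finite σ] {A : Set ℂ} (hA : IsOpen A)
    {l : Filter κ} [l.NeBot] {F : κ → MvPolynomial σ ℂ} {F₀ : MvPolynomial σ ℂ} {n : ℕ}
    (hdeg : ∀ᶠ i in l, (F i).totalDegree ≤ n)
    (hlim : ∀ x, Tendsto (fun i => MvPolynomial.eval x (F i)) l (𝓝 (MvPolynomial.eval x F₀)))
    (hF : ∀ᶠ i in l, ∀ x : σ → ℂ, (∀ v, x v ∈ A) → MvPolynomial.eval x (F i) ≠ 0) :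
    F₀.IsNonvanishing A := by
  refine or_iff_not_imp_right.mpr fun h => MvPolynomial.funext fun y => ?_
  push Not at h
  obtain ⟨x, hx, hx0⟩ := h
  let line (v : σ) : ℂ[X] :=
    Polynomial.C (y v - x v) * Polynomial.X + Polynomial.C (x v)
  have heval_line (t : ℂ) (i : κ) : (MvPolynomial.aeval line (F i)).eval t =
      MvPolynomial.eval (fun v => (line v).eval t) (F i) := by
    rw [← MvPolynomial.aeval_eq_eval, ← Polynomial.coe_aeval_eq_eval]
    exact MvPolynomial.comp_aeval_apply line (Polynomial.aeval t) (F i)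
  obtain ⟨r, hr, hball⟩ : ∃ r > 0, ∀ t : ℂ, ‖t‖ < r → ∀ v, (line v).eval t ∈ A := by
    have : ∀ᶠ t in 𝓝 (0 : ℂ), ∀ v, (line v).eval t ∈ A := eventually_all.mpr fun v =>
      (line v).continuous.continuousAt.eventually_mem (hA.mem_nhds (by simpa [line] using hx v))
    simpa [Metric.eventually_nhds_iff] using this
  have hbound : ∀ᶠ i in l, ‖MvPolynomial.eval y (F i)‖ ≤
      ‖MvPolynomial.eval x (F i)‖ * (1 + ‖(1 : ℂ)‖ / r) ^ (n * 1) := by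
    filter_upwards [hdeg, hF] with i hi hFi
    have := norm_eval_le_of_forall_eval_ne_zero hr
      (MvPolynomial.aeval_natDegree_le (F i) hi line fun v => Polynomial.natDegree_linear_le)
      (fun t ht => (heval_line t i).trans_ne (hFi _ (hball t ht))) 1
    rw [heval_line, heval_line] at this
    simpa [line] using this
  have := le_of_tendsto_of_tendsto (hlim y).norm ((hlim x).norm.mul_const _) hbound
  rw [hx0, norm_zero, zero_mul] at this
  rw [map_zero]
  exact norm_le_zero_iff.mp this

end Hurwitz

section Regions

theorem isOpen_openSector {θ : ℝ} (hθ : θ ≤ Real.pi) : IsOpen (openSector θ) := by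
  rw [isOpen_iff_mem_nhds]
  rintro z ⟨hz0, hz⟩
  have hslit : z ∈ Complex.slitPlane :=
    Complex.mem_slitPlane_iff_arg.mpr ⟨(lt_of_abs_lt (hz.trans_le hθ)).ne, hz0⟩
  filter_upwards [isOpen_ne.mem_nhds hz0,
    (Complex.continuousAt_arg hslit).abs.eventually_lt_const hz] with w h1 h2 using ⟨h1, h2⟩

theorem mul_mem_openSector {a b : ℝ} (hab : a + b ≤ Real.pi) {x z : ℂ} (hx : x ∈ openSector a)
    (hz : z ∈ openSector b) : x * z ∈ openSector (a + b) := by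
  obtain ⟨hx0, hxa⟩ := hx
  obtain ⟨hz0, hzb⟩ := hz
  have habs : |x.arg + z.arg| < a + b := (abs_add_le _ _).trans_lt (add_lt_add hxa hzb)
  have harg := abs_lt.mp (habs.trans_le hab)
  refine ⟨mul_ne_zero hx0 hz0, ?_⟩
  rwa [Complex.arg_mul hx0 hz0 ⟨harg.1, harg.2.le⟩]

theorem mul_add_ne_zero_of_re_neg {w w' l : ℂ} (hw : w.re < 0) (hw' : w'.re < 0) (hl : 0 ≤ l) :
    w * w' + l ≠ 0 := by
  intro h
  have hw0 : w ≠ 0 := by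
    rintro rfl
    exact hw.false
  have hw'_eq : w' = l * -w⁻¹ := by
    rw [mul_neg, ← neg_mul, ← eq_neg_of_add_eq_zero_left h]
    field_simp
  refine hw'.not_ge ?_
  rw [hw'_eq, Complex.eq_re_of_ofReal_le hl, Complex.re_ofReal_mul, Complex.neg_re, Complex.inv_re]
  exact mul_nonneg (Complex.nonneg_iff.mp hl).1
    (neg_nonneg.mpr (div_nonpos_of_nonpos_of_nonneg hw.le (Complex.normSq_nonneg w)))

theorem eval_reverse_ne_zero_of_mem_openDisk {p : ℂ[X]} {κ : ℝ} (hκ : 0 < κ)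
    (h : ∀ z ∈ openExterior κ, p.eval z ≠ 0) {z : ℂ} (hz : z ∈ openDisk κ⁻¹) :
    p.reverse.eval z ≠ 0 := by
  rcases eq_or_ne z 0 with rfl | hz0
  · have hp : p ≠ 0 := by
      rintro rfl
      refine h (κ + 1 : ℝ) ?_ Polynomial.eval_zero
      exact (lt_add_one κ).trans_eq (Complex.norm_of_nonneg (by positivity)).symm
    rwa [← Polynomial.coeff_zero_eq_eval_zero, Polynomial.coeff_zero_reverse,
      Polynomial.leadingCoeff_ne_zero]
  · have hinv : z⁻¹ ∈ openExterior κ := by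
      change κ < ‖z⁻¹‖
      rw [norm_inv]
      exact (lt_inv_comm₀ hκ (norm_pos_iff.mpr hz0)).mpr hz
    let := invertibleOfNonzero (inv_ne_zero hz0)
    simpa using (Polynomial.eval₂_reverse_eq_zero_iff (RingHom.id ℂ) z⁻¹ p).not.mpr (h _ hinv)

end Regions

section Graph

variable {α β : Type*} {G : Graph α β}

theorem exists_ends (G : Graph α β) :
    ∃ s t : E(G) → V(G), ∀ e : E(G), G.IsLink e (s e) (t e) := by
  have h (e : E(G)) : ∃ v w : V(G), G.IsLink e v w := by
    obtain ⟨x, y, hxy⟩ := G.exists_isLink_of_mem_edgeSet e.2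
    exact ⟨⟨x, hxy.left_mem⟩, ⟨y, hxy.right_mem⟩, hxy⟩
  choose s t hst using h
  exact ⟨s, t, hst⟩

section Ends

variable {s t : E(G) → V(G)} (hst : ∀ e : E(G), G.IsLink e (s e) (t e))

include hst

theorem degreeIn_eq_card_add_card [DecidableEq V(G)] (H : Finset E(G)) (v : V(G)) :
    G.degreeIn H v = (H.filter (s · = v)).card + (H.filter (t · = v)).card := by
  classical
  have hinc (e : E(G)) : G.Inc e v ↔ s e = v ∨ t e = v := by
    refine ⟨fun h => ?_, ?_⟩
    · exact (h.eq_or_eq_of_isLink (hst e)).imp (Subtype.ext ·.symm) (Subtype.ext ·.symm)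
    · rintro (rfl | rfl)
      exacts [(hst e).inc_left, (hst e).inc_right]
  have hloop (e : E(G)) : G.IsLoopAt e v ↔ s e = v ∧ t e = v := by
    refine ⟨fun h => ⟨?_, ?_⟩, fun ⟨hs, ht⟩ => ?_⟩
    · exact Subtype.ext (h.eq_of_inc (hst e).inc_left).symm
    · exact Subtype.ext (h.eq_of_inc (hst e).inc_right).symm
    · simpa [hs, ht] using hst e
  rw [← Finset.card_union_add_card_inter, ← Finset.filter_or, ← Finset.filter_and, Graph.degreeIn]
  simp only [hinc, hloop]

theorem prod_ends_eq_prod_pow_degreeIn [Fintype V(G)] {M : Type*} [CommMonoid M] (F : V(G) → M)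
    (H : Finset E(G)) : ∏ e ∈ H, F (s e) * F (t e) = ∏ v, F v ^ G.degreeIn H v := by
  classical
  simp only [degreeIn_eq_card_add_card hst, pow_add, Finset.prod_mul_distrib]
  rw [← Finset.prod_fiberwise' H s F, ← Finset.prod_fiberwise' H t F]
  simp only [Finset.prod_const]

end Ends

variable [Fintype E(G)]

theorem degreeIn_add_degreeIn_compl [DecidableEq E(G)] (H : Finset E(G)) (v : V(G)) :
    G.degreeIn H v + G.degreeIn Hᶜ v = G.degree v := by
  simp only [Graph.degree, Graph.degreeIn, Finset.card_filter, ← Finset.sum_add_distrib]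
  exact Finset.sum_add_sum_compl H _

theorem degreeIn_le_degree (H : Finset E(G)) (v : V(G)) : G.degreeIn H v ≤ G.degree v := by
  classical
  exact (Nat.le_add_right _ _).trans_eq (degreeIn_add_degreeIn_compl H v)

section KeyPoly

variable (u : V(G) → ℕ → ℂ) (v : V(G))

theorem eval_keyPoly (z : ℂ) : (G.keyPoly u v).eval z =
    ∑ j ∈ Finset.range (G.degree v + 1), (G.degree v).choose j * u v j * z ^ j := by
  simp [Graph.keyPoly, Polynomial.eval_finsetSum]

theorem coeff_keyPoly (j : ℕ) : (G.keyPoly u v).coeff j = (G.degree v).choose j * u v j := by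
  simp only [Graph.keyPoly, Polynomial.finsetSum_coeff, Polynomial.coeff_C_mul_X_pow]
  rw [Finset.sum_ite_eq, ite_eq_left_iff, Finset.mem_range, Nat.lt_succ_iff, not_le]
  intro hj
  rw [Nat.choose_eq_zero_of_lt hj, Nat.cast_zero, zero_mul]

variable {u v}

theorem keyPoly_reverse (hdeg : (G.keyPoly u v).natDegree = G.degree v) :
    G.keyPoly (fun v j => u v (G.degree v - j)) v = (G.keyPoly u v).reverse := by
  ext j
  rw [Polynomial.reverse, hdeg, Polynomial.coeff_reflect, coeff_keyPoly, coeff_keyPoly]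
  rcases le_or_gt j (G.degree v) with hj | hj
  · rw [Polynomial.revAt_le hj, Nat.choose_symm hj]
  · rw [Polynomial.revAt_eq_self_of_lt hj, Nat.choose_eq_zero_of_lt hj, Nat.cast_zero, zero_mul,
      zero_mul]

end KeyPoly

variable [Fintype V(G)]

theorem eval_subgraphPoly (lam : E(G) → ℂ) (u : V(G) → ℕ → ℂ) (x : V(G) → ℂ) :
    MvPolynomial.eval x (G.subgraphPoly lam u) =
      ∑ H : Finset E(G), (∏ e ∈ H, lam e) *
        ∏ v, (u v (G.degreeIn H v) * x v ^ G.degreeIn H v) := by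
  simp [Graph.subgraphPoly, Finset.prod_mul_distrib, mul_assoc]

theorem subgraphPoly_eq_applyActivities {s t : E(G) → V(G)}
    (hst : ∀ e : E(G), G.IsLink e (s e) (t e)) (lam : E(G) → ℂ) (u : V(G) → ℕ → ℂ) :
    G.subgraphPoly lam u = applyActivities u
      (∏ e, edgeFactor 0 (lam e) (MvPolynomial.X (s e)) (MvPolynomial.X (t e))) := by
  simp only [edgeFactor, zero_smul, add_zero, one_mul, MvPolynomial.smul_eq_C_mul,
    Finset.prod_one_add, Finset.powerset_univ, map_sum, Graph.subgraphPoly]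
  refine Finset.sum_congr rfl fun H _ => ?_
  rw [Finset.prod_mul_distrib, prod_ends_eq_prod_pow_degreeIn hst, ← map_prod,
    applyActivities_C_mul_prod_X_pow]

variable {lam : E(G) → ℂ} {u : V(G) → ℕ → ℂ}

theorem subgraphPoly_eq_zero_or_eval_keyPoly_ne_zero {A : Set ℂ} (lam : E(G) → ℂ)
    (hK : ∀ v, (G.keyPoly u v).IsNonvanishing A) :
    G.subgraphPoly lam u = 0 ∨ ∀ v, ∀ z ∈ A, (G.keyPoly u v).eval z ≠ 0 := by
  refine or_iff_not_imp_right.mpr fun h => ?_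
  obtain ⟨v, hv⟩ := not_forall.mp h
  have hu (H : Finset E(G)) : u v (G.degreeIn H v) = 0 := by
    have := coeff_keyPoly u v (G.degreeIn H v)
    rw [(hK v).resolve_right hv, Polynomial.coeff_zero, zero_eq_mul, Nat.cast_eq_zero] at this
    exact this.resolve_left (Nat.choose_pos (degreeIn_le_degree H v)).ne'
  refine Finset.sum_eq_zero fun H _ => ?_
  rw [Finset.prod_eq_zero (Finset.mem_univ v) (hu H), mul_zero, map_zero, zero_mul]

theorem eval_applyActivities_prod_edgeFactor_ne_zero {S : Set ℂ} (hS : IsConvexCircularRegion S)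
    {s t : E(G) → V(G)} (hst : ∀ e : E(G), G.IsLink e (s e) (t e)) {x : V(G) → ℂ}
    (hK : ∀ v, ∀ z ∈ S, (G.keyPoly u v).eval (x v * z) ≠ 0) {δ : ℂ} (hδ : δ ∈ S)
    (hlam : ∀ e, ∀ r ∉ S, ∀ r' ∉ S, (r - δ) * (r' - δ) + lam e ≠ 0) :
    MvPolynomial.eval x (applyActivities u
      (∏ e, edgeFactor δ (lam e) (MvPolynomial.X (s e)) (MvPolynomial.X (t e)))) ≠ 0 := by
  let L : MvPolynomial V(G) ℂ →ₗ[ℂ] ℂ :=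
    (MvPolynomial.aeval x).toLinearMap ∘ₗ applyActivities u
  have hdiag (w : V(G) → ℂ) (hw : ∀ v, w v ∈ S) :
      L (∏ e, (1 + w (s e) • MvPolynomial.X (s e)) * (1 + w (t e) • MvPolynomial.X (t e))) ≠ 0 := by
    rw [prod_ends_eq_prod_pow_degreeIn hst fun v => 1 + w v • MvPolynomial.X v]
    refine (eval_applyActivities_prod u (G.degree) x w).trans_ne ?_
    simp only [← eval_keyPoly]
    exact Finset.prod_ne_zero_iff.mpr fun v _ => hK v _ (hw v)
  refine map_prod_edgeFactor_ne_zero hδ (fun e _ => hlam e) L fun z hz => ?_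
  -- Grace–Walsh–Szegő with the half-edges at a vertex as its fibre.
  have := hS.map_prod_ne_zero_of_fiberwise ⟨δ, hδ⟩ (Sum.elim s t) L (a := MvPolynomial.X)
    (y := Sum.elim z z) (fun w hw => by
      simpa [Fintype.prod_sum_type, Finset.prod_mul_distrib] using hdiag w hw)
    (Sum.forall.mpr ⟨hz, hz⟩)
  simpa [Fintype.prod_sum_type, Finset.prod_mul_distrib] using this

theorem eval_subgraphPoly_ne_zero_of_mem_openDisk {κ l : ℝ} (hκ : 0 < κ) (hl : 0 < l)
    (hlam : ∀ e, ‖lam e‖ ≤ l) (hK : ∀ v, ∀ z ∈ openDisk κ, (G.keyPoly u v).eval z ≠ 0)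
    {x : V(G) → ℂ} (hx : ∀ v, x v ∈ openDisk (κ / √l)) :
    MvPolynomial.eval x (G.subgraphPoly lam u) ≠ 0 := by
  have hsl : 0 < √l := Real.sqrt_pos.mpr hl
  obtain ⟨ρ, hxρ, hρ⟩ := exists_between ((pi_norm_lt_iff (div_pos hκ hsl)).mpr hx)
  have hρ0 : 0 < ρ := (norm_nonneg x).trans_lt hxρ
  have hκρ : √l < κ / ρ := (lt_div_comm₀ hρ0 hsl).mp hρ
  obtain ⟨s, t, hst⟩ := exists_ends G
  rw [subgraphPoly_eq_applyActivities hst]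
  refine eval_applyActivities_prod_edgeFactor_ne_zero
    (isConvexCircularRegion_openDisk (hsl.trans hκρ).le) hst (fun v z hz => hK v _ ?_)
    (by simpa [openDisk] using hsl.trans hκρ) fun e r hr r' hr' h0 => (hlam e).not_gt ?_
  · calc ‖x v * z‖ = ‖x v‖ * ‖z‖ := norm_mul _ _
      _ ≤ ρ * ‖z‖ := by gcongr; exact (norm_le_pi_norm x v).trans hxρ.le
      _ < ρ * (κ / ρ) := by gcongr; exact hz
      _ = κ := mul_div_cancel₀ _ hρ0.ne'
  · calc l = √l * √l := (Real.mul_self_sqrt hl.le).symm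
      _ < ‖r‖ * ‖r'‖ := by
        gcongr
        exacts [hκρ.trans_le (not_lt.mp hr), hκρ.trans_le (not_lt.mp hr')]
      _ = ‖lam e‖ := by
        rw [sub_zero, sub_zero] at h0
        rw [← norm_mul, eq_neg_of_add_eq_zero_left h0, norm_neg]

theorem subgraphPoly_isNonvanishing_openDisk {κ l : ℝ} (hκ : 0 < κ) (hl : 0 < l)
    (hlam : ∀ e, ‖lam e‖ ≤ l) (hK : ∀ v, (G.keyPoly u v).IsNonvanishing (openDisk κ)) :
    (G.subgraphPoly lam u).IsNonvanishing (openDisk (κ / √l)) :=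
  (subgraphPoly_eq_zero_or_eval_keyPoly_ne_zero lam hK).imp_right fun hK _ hx =>
    eval_subgraphPoly_ne_zero_of_mem_openDisk hκ hl hlam hK hx

/-- The effect of the complementation `H ↦ E ∖ H` of edge sets. -/
theorem eval_subgraphPoly_eq_mul_eval_inv (hlam : ∀ e, lam e ≠ 0) (u : V(G) → ℕ → ℂ)
    {x : V(G) → ℂ} (hx : ∀ v, x v ≠ 0) :
    MvPolynomial.eval x (G.subgraphPoly lam u) =
      (∏ e, lam e) * (∏ v, x v ^ G.degree v) *
        MvPolynomial.eval x⁻¹ (G.subgraphPoly lam⁻¹ fun v j => u v (G.degree v - j)) := by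
  classical
  rw [eval_subgraphPoly, eval_subgraphPoly, Finset.mul_sum,
    ← Equiv.sum_comp (compl_involutive (α := Finset E(G))).toPerm]
  refine Finset.sum_congr rfl fun H _ => ?_
  have hedge : ∏ e ∈ Hᶜ, lam e = (∏ e, lam e) * ∏ e ∈ H, (lam e)⁻¹ := by
    rw [← Finset.prod_compl_mul_prod H, mul_assoc, ← Finset.prod_mul_distrib,
      Finset.prod_eq_one fun e _ => mul_inv_cancel₀ (hlam e), mul_one]
  have hvertex (v : V(G)) : u v (G.degreeIn Hᶜ v) * x v ^ G.degreeIn Hᶜ v =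
      x v ^ G.degree v * (u v (G.degree v - G.degreeIn H v) * (x v)⁻¹ ^ G.degreeIn H v) := by
    rw [← degreeIn_add_degreeIn_compl H v, Nat.add_sub_cancel_left, pow_add, inv_pow]
    have := pow_ne_zero (G.degreeIn H v) (hx v)
    field_simp
  simp only [Function.Involutive.coe_toPerm, hedge, hvertex, Finset.prod_mul_distrib,
    Pi.inv_apply]
  ring

theorem subgraphPoly_isNonvanishing_openExterior {κ l : ℝ} (hκ : 0 < κ) (hl : 0 < l)
    (hlam : ∀ e, l ≤ ‖lam e‖) (hK : ∀ v, (G.keyPoly u v).IsNonvanishing (openExterior κ))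
    (hdeg : ∀ v, (G.keyPoly u v).natDegree = G.degree v) :
    (G.subgraphPoly lam u).IsNonvanishing (openExterior (κ / √l)) := by
  refine (subgraphPoly_eq_zero_or_eval_keyPoly_ne_zero lam hK).imp_right fun hK x hx => ?_
  have hκl : 0 < κ / √l := div_pos hκ (Real.sqrt_pos.mpr hl)
  have hlam0 (e) : lam e ≠ 0 := norm_pos_iff.mp (hl.trans_le (hlam e))
  have hx0 (v) : x v ≠ 0 := norm_pos_iff.mp (hκl.trans (hx v))
  rw [eval_subgraphPoly_eq_mul_eval_inv hlam0 u hx0]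
  refine mul_ne_zero (mul_ne_zero (Finset.prod_ne_zero_iff.mpr fun e _ => hlam0 e)
    (Finset.prod_ne_zero_iff.mpr fun v _ => pow_ne_zero _ (hx0 v))) ?_
  refine eval_subgraphPoly_ne_zero_of_mem_openDisk (inv_pos.mpr hκ) (inv_pos.mpr hl)
    (fun e => ?_) (fun v z hz => ?_) fun v => ?_
  · rw [Pi.inv_apply, norm_inv]
    exact inv_anti₀ hl (hlam e)
  · rw [keyPoly_reverse (hdeg v)]
    exact eval_reverse_ne_zero_of_mem_openDisk hκ (hK v) hz
  · change ‖(x v)⁻¹‖ < κ⁻¹ / √l⁻¹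
    rw [norm_inv, Real.sqrt_inv, inv_div_inv, ← inv_div]
    exact inv_strictAnti₀ hκl (hx v)

theorem subgraphPoly_isNonvanishing_openSector {a : ℝ} (ha : 0 ≤ a) (hlam : ∀ e, 0 ≤ lam e)
    (hK : ∀ v, (G.keyPoly u v).IsNonvanishing (openSector (Real.pi - a))) :
    (G.subgraphPoly lam u).IsNonvanishing (openSector (Real.pi / 2 - a)) := by
  refine (subgraphPoly_eq_zero_or_eval_keyPoly_ne_zero lam hK).elim Or.inl fun hK => ?_
  obtain ⟨s, t, hst⟩ := exists_ends G
  let F (δ : ℂ) : MvPolynomial V(G) ℂ := applyActivities u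
    (∏ e, edgeFactor δ (lam e) (MvPolynomial.X (s e)) (MvPolynomial.X (t e)))
  -- The disk argument needs `0 ∈ S`, so here `δ ∈ S` tends to the boundary point `0`.
  have : (𝓝[{δ : ℂ | 0 < δ.re}] 0).NeBot := by
    rw [← mem_closure_iff_nhdsWithin_neBot, Complex.closure_setOfPred_lt_re]
    exact (le_refl (0 : ℝ) :)
  rw [subgraphPoly_eq_applyActivities hst]
  refine isNonvanishing_of_tendsto (F := F) (isOpen_openSector (by linarith [Real.pi_pos]))
    (l := 𝓝[{δ : ℂ | 0 < δ.re}] 0) (n := ∑ _e : E(G), 2) (.of_forall fun δ => ?_) (fun x => ?_)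
    (eventually_nhdsWithin_of_forall fun δ hδ x hx => ?_)
  · exact (totalDegree_applyActivities_le u _).trans <|
      (MvPolynomial.totalDegree_finsetProd _ _).trans <| Finset.sum_le_sum fun e _ =>
        totalDegree_edgeFactor_le _ _ (MvPolynomial.totalDegree_X _).le
          (MvPolynomial.totalDegree_X _).le
  · exact (continuous_map_prod_edgeFactor ((MvPolynomial.aeval x).toLinearMap ∘ₗ applyActivities u)
      _ lam _ _).continuousWithinAt
  · refine eval_applyActivities_prod_edgeFactor_ne_zero isConvexCircularRegion_re_pos hst
      (fun v z hz => hK v _ ?_) hδ fun e r hr r' hr' => ?_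
    · have hz' : z ∈ openSector (Real.pi / 2) :=
        ⟨fun h => by simp [h] at hz, Complex.abs_arg_lt_pi_div_two_iff.mpr (Or.inl hz)⟩
      convert mul_mem_openSector (by linarith) (hx v) hz' using 2
      ring
    · refine mul_add_ne_zero_of_re_neg ?_ ?_ (hlam e)
      · exact (Complex.sub_re r δ).trans_lt (sub_neg.mpr ((not_lt.mp hr).trans_lt hδ))
      · exact (Complex.sub_re r' δ).trans_lt (sub_neg.mpr ((not_lt.mp hr').trans_lt hδ))

end Graph

end

theorem theorem3p2 {α β : Type*} (G : Graph α β) [Fintype V(G)] [Fintype E(G)]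
    (lam : E(G) → ℂ) (u : V(G) → ℕ → ℂ) :
    (∀ a : ℝ, 0 ≤ a → a < Real.pi / 2 →
      (∀ e, 0 ≤ lam e) →
      (∀ v, (G.keyPoly u v).IsNonvanishing (openSector (Real.pi - a))) →
      (G.subgraphPoly lam u).IsNonvanishing (openSector (Real.pi / 2 - a))) ∧
    (∀ κ lmax : ℝ, 0 < κ → 0 < lmax →
      (∀ e, ‖lam e‖ ≤ lmax) →
      (∀ v, (G.keyPoly u v).IsNonvanishing (openDisk κ)) →
      (G.subgraphPoly lam u).IsNonvanishing (openDisk (κ / √lmax))) ∧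
    (∀ κ lmin : ℝ, 0 < κ → 0 < lmin →
      (∀ e, lmin ≤ ‖lam e‖) →
      (∀ v, (G.keyPoly u v).IsNonvanishing (openExterior κ)) →
      (∀ v, (G.keyPoly u v).natDegree = G.degree v) →
      (G.subgraphPoly lam u).IsNonvanishing (openExterior (κ / √lmin))) :=
  ⟨fun _ ha _ => subgraphPoly_isNonvanishing_openSector ha,
    fun _ _ => subgraphPoly_isNonvanishing_openDisk,
    fun _ _ => subgraphPoly_isNonvanishing_openExterior⟩
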